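/- Let $G$ be a finite simple undirected graph that is outerplanar, i.e. $G$ has a drawing in the plane (distinct vertices are distinct points, each edge is a polygonal arc joining its two ends, and the interior of an edge contains no vertex and no point of any other edge) in which every vertex lies on the boundary of the outer (unbounded) face. Then $G$ is cop-win if and only if $G$ is connected and chordal. Here $G$ is chordal if it has no induced cycle of length greater than $3$. It is cop-win if a single cop has a winning strategy in the game of Cops and Robbers: the cop chooses a vertex, then the robber chooses a vertex; in each round first the cop and then the robber either moves to a neighbor of the vertex currently occupied or remains there, both players having perfect information; the cop wins if at some time both players occupy the same vertex. -/

import Mathlib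

/-! ### The game of Cops and Robbers with one cop -/

namespace CopsRobbers

variable {V : Type*}

/-- One move of a player: stay at the current vertex or go to a neighbour of it. -/
def Move (G : SimpleGraph V) (u v : V) : Prop := u = v ∨ G.Adj u v

/-- A strategy of the cop: an initial vertex, and the vertex `move h c r` to which the cop goes in
the next round, as a function of the list `h` of all earlier positions (cop, robber) of the game
(the most recent one first) and of the present vertices `c` of the cop and `r` of the robber. -/
structure CopStrategy (G : SimpleGraph V) where
  start : V
  move : List (V × V) → V → V → V
  legal : ∀ h c r, Move G c (move h c r)

/-- The history and the cop's vertex after `t` rounds, when the cop follows the strategy `σ` and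
the robber starts at `r 0` and is at `r t` after `t` rounds. -/
def CopStrategy.state {G : SimpleGraph V} (σ : CopStrategy G) (r : ℕ → V) : ℕ → List (V × V) × V
  | 0 => ([], σ.start)
  | t + 1 =>
    let s := σ.state r t
    ((s.2, r t) :: s.1, σ.move s.1 s.2 (r t))

/-- The cop's vertex after `t` rounds. -/
def CopStrategy.cop {G : SimpleGraph V} (σ : CopStrategy G) (r : ℕ → V) (t : ℕ) : V :=
  (σ.state r t).2

/-- The robber is captured: either both players are on the same vertex after some round `t`
(`t = 0` being the initial placement), or the cop, who moves first in each round, moves in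
round `t + 1` to the vertex of the robber. -/
def CopStrategy.Captures {G : SimpleGraph V} (σ : CopStrategy G) (r : ℕ → V) : Prop :=
  ∃ t, σ.cop r t = r t ∨ σ.cop r (t + 1) = r t

/-- `G` is cop-win: one cop has a strategy that captures the robber, however the robber plays. -/
def IsCopWin (G : SimpleGraph V) : Prop :=
  ∃ σ : CopStrategy G, ∀ r : ℕ → V, (∀ t, Move G (r t) (r (t + 1))) → σ.Captures r

/-! ### Chordal graphs -/

/-- `G` has no induced cycle of length greater than `3`. -/
def IsChordal (G : SimpleGraph V) : Prop :=
  ∀ n : ℕ, 3 < n → ¬ (SimpleGraph.cycleGraph n).IsIndContained G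

/-! ### Outerplanar graphs -/

/-- The Euclidean plane. -/
abbrev Plane : Type := EuclideanSpace ℝ (Fin 2)

/-- `A` is a (polygonal) arc with ends `x` and `y`: the union of the segments
`[p 0, p 1], …, [p (n - 1), p n]` of a polygonal path from `p 0 = x` to `p n = y` that does not meet
itself, that is, consecutive segments share only their common end and all others are disjoint. -/
def IsPolygonalArc (A : Set Plane) (x y : Plane) : Prop :=
  ∃ (n : ℕ) (p : ℕ → Plane), 0 < n ∧ p 0 = x ∧ p n = y ∧
    (∀ i < n, p i ≠ p (i + 1)) ∧
    (∀ i, i + 1 < n →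
      segment ℝ (p i) (p (i + 1)) ∩ segment ℝ (p (i + 1)) (p (i + 2)) = {p (i + 1)}) ∧
    (∀ i j, i + 1 < j → j < n →
      Disjoint (segment ℝ (p i) (p (i + 1))) (segment ℝ (p j) (p (j + 1)))) ∧
    A = ⋃ i ∈ Set.Iio n, segment ℝ (p i) (p (i + 1))

/-- A drawing of `G` in the plane: distinct vertices are distinct points, an edge `uv` is an arc
between the points `u` and `v`, and the interior of an edge contains no vertex and no point of
another edge. -/
structure PlaneDrawing (G : SimpleGraph V) where
  pos : V → Plane
  arc : G.edgeSet → Set Plane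
  pos_injective : Function.Injective pos
  isArc : ∀ (u v : V) (h : G.Adj u v), IsPolygonalArc (arc ⟨s(u, v), h⟩) (pos u) (pos v)
  vertex_on_arc : ∀ (e : G.edgeSet) (w : V), pos w ∈ arc e → w ∈ (e : Sym2 V)
  arc_inter_arc : ∀ e f : G.edgeSet, e ≠ f → arc e ∩ arc f ⊆ Set.range pos

/-- All points of the plane that are used by the drawing. -/
def PlaneDrawing.support {G : SimpleGraph V} (D : PlaneDrawing G) : Set Plane :=
  Set.range D.pos ∪ ⋃ e, D.arc e

/-- The outer (unbounded) face: the points off the drawing whose connected component in the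
complement of the drawing is unbounded. -/
def PlaneDrawing.outerFace {G : SimpleGraph V} (D : PlaneDrawing G) : Set Plane :=
  {x | x ∈ D.supportᶜ ∧ ¬ Bornology.IsBounded (connectedComponentIn D.supportᶜ x)}

/-- `G` is outerplanar: it has a drawing in the plane in which every vertex lies on the boundary of
the outer face. -/
def IsOuterplanar (G : SimpleGraph V) : Prop :=
  ∃ D : PlaneDrawing G, ∀ v : V, D.pos v ∈ frontier D.outerFace

end CopsRobbers

/-! A chordal graph has a simplicial vertex `z` (Dirac), and any neighbour `u` of `z` dominates it.
Folding `z` onto `u` lets the cop play the smaller graph against the robber's shadow, so a finite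
connected chordal graph is cop-win by induction (`IsChordal.exists_canCapture`).

Conversely, a robber who starts in another component is never caught, so a cop-win graph is
connected. Suppose an outerplanar `G` has an induced cycle `C` of length at least 4. Each component
of `G - C` attaches only to pairwise equal or adjacent vertices of `C`, so sending the component to
one of them retracts `G` onto `C` (`IsOuterplanar.exists_retraction`). The robber then stays on `C`
and evades the cop's image there.

If a component were attached to non-adjacent `x`, `y` of `C`, there would be three paths from `x` to
`y`, disjoint except at their ends, with the second vertex `m i` of each on the boundary of the
outer face. `not_three_arcs` excludes this with angles in place of the Jordan curve theorem. Two
curves from `x` to `y` are seen from a point off both under total angles that differ by 2π times a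
winding number. This number is locally constant and vanishes on the outer face, hence also at a
boundary point off both curves. So from `m i` the two other curves are seen under the same angle.
Moving the viewpoint along the arc from `m i` to `x` gives one linear relation for each `i`.
Together they force the three signed exterior angles at `x` to sum to 0, whereas their sum is π
modulo 2π. -/

namespace CopsRobbers

/-! ### Viewing angles of plane curves and the three-arc obstruction -/

open Filter Topology Complex

/-- The plane as the complex numbers. -/
noncomputable def toComplex : Plane ≃ₗᵢ[ℝ] ℂ := Complex.orthonormalBasisOneI.repr.symm

/-- The angle, in `(-π, π]`, under which the segment from `a` to `b` is seen from `p`. -/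
noncomputable def viewAngle (a b p : Plane) : ℝ :=
  arg ((toComplex b - toComplex p) / (toComplex a - toComplex p))

/-- `A` measures the total angle under which a curve from `a` to `b` inside `K` is seen from the
points off `K`. -/
structure IsAngle (K : Set Plane) (a b : Plane) (A : Plane → ℝ) : Prop where
  isClosed : IsClosed K
  left_mem : a ∈ K
  right_mem : b ∈ K
  continuousOn : ContinuousOn A Kᶜ
  coe_eq : ∀ p ∉ K, (A p : Real.Angle) =
    (arg (toComplex b - toComplex p) : Real.Angle) - (arg (toComplex a - toComplex p) : Real.Angle)
  tendsto : Tendsto A (Bornology.cobounded Plane) (𝓝 0)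

theorem IsAngle.refl (a : Plane) : IsAngle {a} a a 0 where
  isClosed := isClosed_singleton
  left_mem := rfl
  right_mem := rfl
  continuousOn := continuousOn_const
  coe_eq p _ := by simp
  tendsto := tendsto_const_nhds

theorem IsAngle.trans {K L : Set Plane} {a b c : Plane} {A B : Plane → ℝ} (h : IsAngle K a b A)
    (h' : IsAngle L b c B) : IsAngle (K ∪ L) a c (A + B) where
  isClosed := h.isClosed.union h'.isClosed
  left_mem := Or.inl h.left_mem
  right_mem := Or.inr h'.right_mem
  continuousOn := by
    refine (h.continuousOn.mono ?_).add (h'.continuousOn.mono ?_) <;>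
      exact Set.compl_subset_compl.2 (by simp)
  coe_eq p hp := by
    rw [Set.mem_union, not_or] at hp
    simp [h.coe_eq p hp.1, h'.coe_eq p hp.2]
  tendsto := by
    have := h.tendsto.add h'.tendsto
    rwa [add_zero] at this

/-- A quotient that is real and nonpositive would place `p` between `a` and `b`. Off the segment,
`arg` therefore stays away from its branch cut and `viewAngle` is continuous. -/
theorem div_mem_slitPlane {a b p : Plane} (hp : p ∉ segment ℝ a b) :
    (toComplex b - toComplex p) / (toComplex a - toComplex p) ∈ slitPlane := by
  by_contra h
  have hap : toComplex a - toComplex p ≠ 0 := by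
    intro h0
    rw [sub_eq_zero, toComplex.injective.eq_iff] at h0
    exact hp (h0 ▸ left_mem_segment ℝ a b)
  set q := (toComplex b - toComplex p) / (toComplex a - toComplex p) with hq
  rw [mem_slitPlane_iff, not_or, not_lt, not_not] at h
  obtain ⟨h1, h2⟩ := h
  have hqr : q = ((q.re : ℝ) : ℂ) := Complex.ext (by simp) (by simpa using h2)
  have e : toComplex b - toComplex p = (q.re : ℂ) * (toComplex a - toComplex p) := by
    rw [← hqr, hq, div_mul_cancel₀ _ hap]
  have e' : b - p = q.re • (a - p) := by
    apply toComplex.injective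
    simpa using e
  apply hp
  have hs : (0 : ℝ) < 1 - q.re := by linarith
  refine ⟨-q.re / (1 - q.re), 1 / (1 - q.re), ?_, ?_, ?_, ?_⟩
  · exact div_nonneg (by linarith) hs.le
  · positivity
  · field_simp
    ring
  · have hb : b = p + q.re • (a - p) := by rw [← e']; abel
    rw [hb]
    match_scalars <;> field_simp <;> ring

theorem isAngle_segment (a b : Plane) : IsAngle (segment ℝ a b) a b (viewAngle a b) where
  isClosed := by
    rw [← convexHull_pair]
    exact (Set.toFinite {a, b}).isClosed_convexHull ℝ
  left_mem := left_mem_segment ℝ a b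
  right_mem := right_mem_segment ℝ a b
  continuousOn := by
    intro p hp
    apply ContinuousAt.continuousWithinAt
    have hap : toComplex a - toComplex p ≠ 0 := by
      intro h0
      rw [sub_eq_zero, toComplex.injective.eq_iff] at h0
      exact hp (h0 ▸ left_mem_segment ℝ a b)
    have hc := toComplex.continuous
    exact ContinuousAt.comp (g := arg) (continuousAt_arg (div_mem_slitPlane hp))
      (ContinuousAt.div (by fun_prop) (by fun_prop) hap)
  coe_eq p hp := by
    have hap : toComplex a - toComplex p ≠ 0 := by
      intro h0
      rw [sub_eq_zero, toComplex.injective.eq_iff] at h0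
      exact hp (h0 ▸ left_mem_segment ℝ a b)
    have hbp : toComplex b - toComplex p ≠ 0 := by
      intro h0
      rw [sub_eq_zero, toComplex.injective.eq_iff] at h0
      exact hp (h0 ▸ right_mem_segment ℝ a b)
    exact arg_div_coe_angle hbp hap
  tendsto := by
    have h1 : Tendsto (fun p => toComplex a - toComplex p) (Bornology.cobounded Plane)
        (Bornology.cobounded ℂ) := by
      have : Tendsto toComplex (Bornology.cobounded Plane) (Bornology.cobounded ℂ) := by
        rw [← tendsto_norm_atTop_iff_cobounded]
        simpa using tendsto_norm_cobounded_atTop (E := Plane)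
      rw [← tendsto_norm_atTop_iff_cobounded] at this ⊢
      refine tendsto_atTop_mono (fun p => ?_) (tendsto_atTop_add_const_right _ (-‖toComplex a‖) this)
      have := norm_sub_norm_le (toComplex p) (toComplex a)
      rw [norm_sub_rev] at this
      linarith
    -- This expression is the quotient defining `viewAngle a b p`, rewritten so that its limit 1 at
    -- infinity is visible.
    have h2 : Tendsto (fun p => 1 + (toComplex b - toComplex a) / (toComplex a - toComplex p))
        (Bornology.cobounded Plane) (𝓝 1) := by
      have := (tendsto_inv₀_cobounded.comp h1).const_mul (toComplex b - toComplex a)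
      simpa [div_eq_mul_inv] using this.const_add 1
    have h3 := (continuousAt_arg one_mem_slitPlane).tendsto.comp h2
    rw [arg_one] at h3
    refine h3.congr' ?_
    have hne : ∀ᶠ p in Bornology.cobounded Plane, p ≠ a :=
      Bornology.isBounded_def.1 (Bornology.isBounded_singleton (x := a))
    filter_upwards [hne] with p hp
    have hap : toComplex a - toComplex p ≠ 0 := by
      rw [sub_ne_zero]
      exact fun h => hp (toComplex.injective h).symm
    simp only [Function.comp, viewAngle]
    congr 1
    field_simp
    ring

theorem IsAngle.exists_int {K L : Set Plane} {a b : Plane} {A B : Plane → ℝ} (h : IsAngle K a b A)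
    (h' : IsAngle L a b B) {p : Plane} (hp : p ∉ K) (hp' : p ∉ L) :
    ∃ k : ℤ, A p - B p = 2 * Real.pi * k := by
  rw [← Real.Angle.angle_eq_iff_two_pi_dvd_sub, h.coe_eq p hp, h'.coe_eq p hp']

/-- The difference is continuous on `T` with values in 2πℤ. Two distinct values would force an
intermediate value at an odd multiple of π. -/
theorem IsAngle.sub_eq_of_isPreconnected {K L : Set Plane} {a b : Plane} {A B : Plane → ℝ}
    (h : IsAngle K a b A) (h' : IsAngle L a b B) {T : Set Plane} (hT : IsPreconnected T)
    (hK : Disjoint T K) (hL : Disjoint T L) {p q : Plane} (hp : p ∈ T) (hq : q ∈ T) :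
    A p - B p = A q - B q := by
  have hc : ContinuousOn (fun z => A z - B z) T :=
    (h.continuousOn.mono hK.subset_compl_right).sub (h'.continuousOn.mono hL.subset_compl_right)
  have key : ∀ p ∈ T, ∀ q ∈ T, ¬ A p - B p < A q - B q := by
    intro p hp q hq hlt
    obtain ⟨k, hk⟩ := h.exists_int h' (Set.disjoint_left.1 hK hp) (Set.disjoint_left.1 hL hp)
    obtain ⟨l, hl⟩ := h.exists_int h' (Set.disjoint_left.1 hK hq) (Set.disjoint_left.1 hL hq)
    have hpi := Real.pi_pos
    have hkl : k + 1 ≤ l := by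
      rw [hk, hl] at hlt
      exact_mod_cast lt_of_mul_lt_mul_left hlt (by positivity)
    have hkl' : (k : ℝ) + 1 ≤ l := by exact_mod_cast hkl
    obtain ⟨z, hz, hze⟩ := hT.intermediate_value hp hq hc
      (show 2 * Real.pi * k + Real.pi ∈ Set.Icc _ _ by
        simp only [hk, hl]
        constructor <;> nlinarith)
    obtain ⟨m, hm⟩ := h.exists_int h' (Set.disjoint_left.1 hK hz) (Set.disjoint_left.1 hL hz)
    simp only [hm] at hze
    have : (2 * m : ℝ) = 2 * k + 1 := by
      apply mul_left_cancel₀ hpi.ne'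
      linarith
    have : 2 * m = 2 * k + 1 := by exact_mod_cast this
    omega
  exact le_antisymm (not_lt.1 (key q hq p hp)) (not_lt.1 (key p hp q hq))

/-- The difference is constant on `T`, which reaches infinity, where both angles tend to 0. -/
theorem IsAngle.sub_eq_zero_of_not_isBounded {K L : Set Plane} {a b : Plane} {A B : Plane → ℝ}
    (h : IsAngle K a b A) (h' : IsAngle L a b B) {T : Set Plane} (hT : IsPreconnected T)
    (hK : Disjoint T K) (hL : Disjoint T L) (hTb : ¬ Bornology.IsBounded T) {p : Plane}
    (hp : p ∈ T) : A p - B p = 0 := by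
  have h0 : Tendsto (fun z => A z - B z) (Bornology.cobounded Plane) (𝓝 0) := by
    simpa using h.tendsto.sub h'.tendsto
  have hf : ∃ᶠ z in Bornology.cobounded Plane, z ∈ T := by
    intro hev
    exact hTb (Bornology.isBounded_def.2 hev)
  have h1 : ∃ᶠ z in Bornology.cobounded Plane, A z - B z = A p - B p :=
    hf.mono fun z hz => h.sub_eq_of_isPreconnected h' hT hK hL hz hp
  have := isClosed_singleton.mem_of_frequently_of_tendsto (x := (0 : ℝ)) (s := {A p - B p}) h1 h0
  exact this.symm

theorem IsAngle.eq_of_mem_closure {K L : Set Plane} {a b : Plane} {A B : Plane → ℝ}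
    (h : IsAngle K a b A) (h' : IsAngle L a b B) {O : Set Plane} (hO : ∀ z ∈ O, A z - B z = 0)
    {m : Plane} (hm : m ∈ closure O) (hmK : m ∉ K) (hmL : m ∉ L) : A m = B m := by
  have hA := (h.continuousOn.continuousAt (h.isClosed.isOpen_compl.mem_nhds hmK)).tendsto
  have hB := (h'.continuousOn.continuousAt (h'.isClosed.isOpen_compl.mem_nhds hmL)).tendsto
  have hf : ∃ᶠ z in 𝓝 m, A z - B z = 0 := (mem_closure_iff_frequently.1 hm).mono hO
  have := isClosed_singleton.mem_of_frequently_of_tendsto (s := {(0 : ℝ)}) hf (hA.sub hB)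
  exact sub_eq_zero.1 this

/-- As `p` tends to `x` along the segment `[x, v]`, the angle of `[x, w]` seen from `p` tends to
the exterior angle at `x`. -/
theorem tendsto_viewAngle {x v w : Plane} (hv : v ≠ x) (hw : w ≠ x)
    (hd : ∀ t : ℝ, 0 < t → t ≤ 1 → x + t • (v - x) ∉ segment ℝ x w) :
    -(toComplex (w - x) / toComplex (v - x)) ∈ slitPlane ∧
    Tendsto (fun t : ℝ => viewAngle x w (x + t • (v - x))) (𝓝[>] 0)
      (𝓝 (arg (-(toComplex (w - x) / toComplex (v - x))))) := by
  have hv0 : toComplex (v - x) ≠ 0 := by simpa [sub_eq_zero] using hv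
  have hw0 : toComplex (w - x) ≠ 0 := by simpa [sub_eq_zero] using hw
  have hs : -(toComplex (w - x) / toComplex (v - x)) ∈ slitPlane := by
    by_contra h
    set q := toComplex (w - x) / toComplex (v - x) with hq
    rw [mem_slitPlane_iff, not_or, not_lt, not_not] at h
    obtain ⟨h1, h2⟩ := h
    simp only [neg_re, neg_im, neg_eq_zero, neg_nonpos] at h1 h2
    have hqr : q = ((q.re : ℝ) : ℂ) := Complex.ext (by simp) (by simpa using h2)
    have hq0 : q ≠ 0 := div_ne_zero hw0 hv0
    have hr : 0 < q.re := lt_of_le_of_ne h1 fun h => hq0 (by rw [hqr, ← h]; simp)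
    have e : w - x = q.re • (v - x) := by
      apply toComplex.injective
      rw [map_smul, real_smul, ← hqr, hq, div_mul_cancel₀ _ hv0]
    -- A positive real `q` makes the two segments leave `x` in the same direction; the shorter one's
    -- end lies on both.
    refine hd (min 1 q.re) (lt_min one_pos hr) (min_le_left _ _) ?_
    rw [segment_eq_image']
    refine ⟨min 1 q.re / q.re, ⟨by positivity, ?_⟩, ?_⟩
    · rw [div_le_one hr]
      exact min_le_right _ _
    · simp only [e, smul_smul]
      rw [div_mul_cancel₀ _ hr.ne']
  refine ⟨hs, ?_⟩
  have hlim : Tendsto (fun t : ℝ => -((toComplex (w - x) - (t : ℂ) * toComplex (v - x)) /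
      toComplex (v - x))) (𝓝[>] 0) (𝓝 (-(toComplex (w - x) / toComplex (v - x)))) := by
    have : Continuous (fun t : ℝ => -((toComplex (w - x) - (t : ℂ) * toComplex (v - x)) /
      toComplex (v - x))) := by fun_prop
    simpa using (this.tendsto 0).mono_left nhdsWithin_le_nhds
  refine ((continuousAt_arg hs).tendsto.comp hlim).congr' ?_
  filter_upwards [self_mem_nhdsWithin] with t ht
  have ht : 0 < t := ht
  simp only [Function.comp, viewAngle]
  rw [← arg_real_mul _ (inv_pos.2 ht)]
  congr 1
  have ht' : (t : ℂ) ≠ 0 := by exact_mod_cast ht.ne'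
  simp only [map_add, map_smul, real_smul, map_sub] at hv0 ⊢
  have e1 : toComplex x - (toComplex x + t * (toComplex v - toComplex x)) =
    -(t * (toComplex v - toComplex x)) := by ring
  rw [e1]
  push_cast
  field_simp
  ring

/-- The local form of the fact that the unbounded face of a plane theta graph is bounded by only
two of its three arcs. -/
theorem not_three_arcs {x y : Plane} {v : Fin 3 → Plane} {K : Fin 3 → Set Plane}
    {B : Fin 3 → Plane → ℝ} (hv : ∀ i, v i ≠ x) (hB : ∀ i, IsAngle (K i) (v i) y (B i))
    (hx : ∀ i, x ∉ K i) {T : Fin 3 → Set Plane} (hT : ∀ i, IsPreconnected (T i))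
    (hvT : ∀ i, ∀ t : ℝ, 0 < t → t ≤ 1 → x + t • (v i - x) ∈ T i)
    (hd : ∀ i j, i ≠ j → Disjoint (T i) (segment ℝ x (v j) ∪ K j))
    {O : Set Plane}
    (hO : ∀ z ∈ O, ∃ C, IsPreconnected C ∧ z ∈ C ∧ ¬ Bornology.IsBounded C ∧
      ∀ i, Disjoint C (segment ℝ x (v i) ∪ K i))
    {m : Fin 3 → Plane} (hm : ∀ i, m i ∈ T i) (hmO : ∀ i, m i ∈ closure O) : False := by
  have hA i : IsAngle (segment ℝ x (v i) ∪ K i) x y (viewAngle x (v i) + B i) :=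
    (isAngle_segment x (v i)).trans (hB i)
  set a : Fin 3 → Fin 3 → ℝ := fun i j =>
    arg (-(toComplex (v j - x) / toComplex (v i - x))) with ha
  have hseg : ∀ i j, i ≠ j → ∀ t : ℝ, 0 < t → t ≤ 1 → x + t • (v i - x) ∉ segment ℝ x (v j) :=
    fun i j hij t h0 h1 hmem => Set.disjoint_left.1 (hd i j hij) (hvT i t h0 h1) (Or.inl hmem)
  -- Curves `j` and `k` are seen under equal angles from `m i`, hence from all of `T i`; the two
  -- sides are the limits of these angles at `x`.
  have key : ∀ i j k, i ≠ j → i ≠ k → a i j + B j x = a i k + B k x := by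
    intro i j k hij hik
    have hlim : ∀ l, i ≠ l → Tendsto
        (fun t : ℝ => (viewAngle x (v l) + B l) (x + t • (v i - x))) (𝓝[>] 0)
        (𝓝 (a i l + B l x)) := by
      intro l hil
      refine (tendsto_viewAngle (hv i) (hv l) (hseg i l hil)).2.add ?_
      have hc := ((hB l).continuousOn.continuousAt
        ((hB l).isClosed.isOpen_compl.mem_nhds (hx l))).tendsto
      refine hc.comp ?_
      have : Continuous fun t : ℝ => x + t • (v i - x) := by fun_prop
      simpa using (this.tendsto 0).mono_left (nhdsWithin_le_nhds (s := Set.Ioi 0))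
    refine tendsto_nhds_unique_of_eventuallyEq (hlim j hij) (hlim k hik) ?_
    have h1 : ∀ᶠ t : ℝ in 𝓝[>] 0, t ≤ 1 :=
      nhdsWithin_le_nhds (Iic_mem_nhds one_pos)
    filter_upwards [self_mem_nhdsWithin, h1] with t ht ht1
    have hmeq : (viewAngle x (v j) + B j) (m i) = (viewAngle x (v k) + B k) (m i) := by
      refine (hA j).eq_of_mem_closure (hA k) (fun z hz => ?_) (hmO i)
        (Set.disjoint_left.1 (hd i j hij) (hm i)) (Set.disjoint_left.1 (hd i k hik) (hm i))
      obtain ⟨C, hC, hzC, hCb, hCd⟩ := hO z hz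
      exact (hA j).sub_eq_zero_of_not_isBounded (hA k) hC (hCd j) (hCd k) hCb hzC
    have := (hA j).sub_eq_of_isPreconnected (hA k) (hT i) (hd i j hij) (hd i k hik)
      (hvT i t ht ht1) (hm i)
    linarith
  have hsymm : ∀ i j, i ≠ j → a j i = - a i j := by
    intro i j hij
    have := (tendsto_viewAngle (hv i) (hv j) (hseg i j hij)).1
    simp only [ha]
    -- Antisymmetry of `arg` under inversion fails only at argument π, which the slit plane
    -- excludes.
    rw [← inv_div, ← inv_neg, arg_inv, if_neg (mem_slitPlane_iff_arg.1 this).1]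
  have h0 := key 0 1 2 (by decide) (by decide)
  have h1 := key 1 0 2 (by decide) (by decide)
  have h2 := key 2 0 1 (by decide) (by decide)
  rw [hsymm 0 1 (by decide)] at h1
  rw [hsymm 1 2 (by decide)] at h2
  have hs := hsymm 0 2 (by decide)
  have hsum : a 0 1 + a 1 2 + a 2 0 = 0 := by linarith
  have hne : ∀ i, toComplex (v i - x) ≠ 0 := fun i => by simpa [sub_eq_zero] using hv i
  -- The three quotients multiply to 1, and the three minus signs leave -1.
  have hang : ((a 0 1 + a 1 2 + a 2 0 : ℝ) : Real.Angle) = (Real.pi : ℝ) := by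
    simp only [ha, Real.Angle.coe_add]
    have n i j : -(toComplex (v j - x) / toComplex (v i - x)) ≠ 0 :=
      neg_ne_zero.2 (div_ne_zero (hne j) (hne i))
    rw [← arg_mul_coe_angle (n 0 1) (n 1 2),
      ← arg_mul_coe_angle (mul_ne_zero (n 0 1) (n 1 2)) (n 2 0), ← arg_neg_one]
    congr 2
    have := hne 0
    have := hne 1
    have := hne 2
    field_simp
  rw [hsum, Real.Angle.coe_zero] at hang
  exact Real.Angle.pi_ne_zero hang.symm

end CopsRobbers

/-! ### Strategies for the robber and for the cop -/

namespace CopsRobbers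

variable {V : Type*} {G : SimpleGraph V}

/-- The history, the cop's vertex and the robber's vertex after `t` rounds, when the cop follows `σ`
and the robber answers by `esc`. -/
def CopStrategy.play (σ : CopStrategy G) (r₀ : V) (esc : V → V → V) : ℕ → (List (V × V) × V) × V
  | 0 => (([], σ.start), r₀)
  | t + 1 =>
    let s := σ.play r₀ esc t
    let c := σ.move s.1.1 s.1.2 s.2
    (((s.1.2, s.2) :: s.1.1, c), esc c s.2)

theorem CopStrategy.state_play (σ : CopStrategy G) (r₀ : V) (esc : V → V → V) (t : ℕ) :
    σ.state (fun t => (σ.play r₀ esc t).2) t = (σ.play r₀ esc t).1 := by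
  induction t with
  | zero => rfl
  | succ t ih => simp only [CopStrategy.state, CopStrategy.play, ih]

/-- The robber escapes forever if there is a relation `S` between the vertices of the cop and of the
robber that the robber can maintain. -/
theorem not_isCopWin_of_safe (S : V → V → Prop) (hstart : ∀ c, ∃ r, S c r)
    (hne : ∀ c r, S c r → c ≠ r)
    (hstep : ∀ c r c', S c r → Move G c c' → c' ≠ r ∧ ∃ r', Move G r r' ∧ S c' r') :
    ¬ IsCopWin G := by
  classical
  rintro ⟨σ, hσ⟩
  obtain ⟨r₀, h₀⟩ := hstart σ.start
  let esc : V → V → V := fun c r =>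
    if h : ∃ r', Move G r r' ∧ S c r' then h.choose else r
  have hesc : ∀ c r, (∃ r', Move G r r' ∧ S c r') → Move G r (esc c r) ∧ S c (esc c r) := by
    intro c r h
    simp only [esc, dif_pos h]
    exact h.choose_spec
  have hS : ∀ t, S (σ.play r₀ esc t).1.2 (σ.play r₀ esc t).2 := by
    intro t
    induction t with
    | zero => exact h₀
    | succ t ih => exact (hesc _ _ (hstep _ _ _ ih (σ.legal _ _ _)).2).2
  obtain ⟨t, ht⟩ := hσ (fun t => (σ.play r₀ esc t).2) fun t =>
    (hesc _ _ (hstep _ _ _ (hS t) (σ.legal _ _ _)).2).1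
  simp only [CopStrategy.cop, CopStrategy.state_play] at ht
  rcases ht with ht | ht
  · exact hne _ _ (hS t) ht
  · exact (hstep _ _ _ (hS t) (σ.legal _ _ _)).1 ht

/-- The relation kept by the robber is not being reachable from the cop. -/
theorem IsCopWin.connected (h : IsCopWin G) : G.Connected := by
  have hne : Nonempty V := h.elim fun σ _ => ⟨σ.start⟩
  by_contra hc
  have hp : ¬ G.Preconnected := fun hp => hc ⟨hp⟩
  refine not_isCopWin_of_safe (fun c r => ¬ G.Reachable c r) (fun c => ?_)
    (fun c r hcr e => hcr (e ▸ SimpleGraph.Reachable.refl c)) (fun c r c' hcr hm => ?_) h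
  · by_contra! hr
    exact hp fun u v => (hr u).symm.trans (hr v)
  · have hcc : G.Reachable c c' := by
      rcases hm with rfl | hm
      · exact SimpleGraph.Reachable.refl c
      · exact hm.reachable
    exact ⟨fun e => hcr (e ▸ hcc), r, Or.inl rfl, fun h => hcr (hcc.trans h)⟩

/-- In the game on the subgraph induced by `X`, the cop, whose turn it is, can capture the robber
within `k` rounds. -/
def CanCapture (G : SimpleGraph V) (X : Set V) : ℕ → V → V → Prop
  | 0, _, _ => False
  | k + 1, c, r => ∃ c' ∈ X, Move G c c' ∧
      (c' = r ∨ ∀ r' ∈ X, Move G r r' → CanCapture G X k c' r')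

/-- A strategy does not see the round bound, so at each position the cop plays a move that realises
the least possible bound. This bound then decreases until capture. -/
theorem isCopWin_of_canCapture {k : ℕ} {c : V} (h : ∀ r, CanCapture G Set.univ k c r) :
    IsCopWin G := by
  classical
  have hmv : ∀ c r, ∃ c', Move G c c' ∧ ∀ k, CanCapture G Set.univ (k + 1) c r →
      (∀ l < k + 1, ¬ CanCapture G Set.univ l c r) →
      c' = r ∨ ∀ r', Move G r r' → CanCapture G Set.univ k c' r' := by
    intro c r
    by_cases hk : ∃ k, CanCapture G Set.univ (k + 1) c r ∧
      ∀ l < k + 1, ¬ CanCapture G Set.univ l c r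
    · obtain ⟨k, hk, hmin⟩ := hk
      have hk' := hk
      obtain ⟨c', -, hm, h'⟩ := hk'
      refine ⟨c', hm, fun l hl hlmin => ?_⟩
      have : l = k := by
        by_contra hlk
        rcases lt_or_gt_of_ne hlk with h | h
        · exact hmin (l + 1) (by omega) hl
        · exact hlmin (k + 1) (by omega) hk
      subst this
      exact h'.imp id fun h r' hr' => h r' trivial hr'
    · push Not at hk
      refine ⟨c, Or.inl rfl, fun k hk1 hk2 => ?_⟩
      obtain ⟨l, hl, hl'⟩ := hk k hk1
      exact absurd hl' (hk2 l hl)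
  choose mv hmv1 hmv2 using hmv
  let σ : CopStrategy G := ⟨c, fun _ c r => mv c r, fun _ c r => hmv1 c r⟩
  refine ⟨σ, fun r hr => ?_⟩
  have key : ∀ k t, CanCapture G Set.univ k (σ.cop r t) (r t) → σ.Captures r := by
    intro k
    induction k using Nat.strong_induction_on with
    | _ k ih =>
      intro t ht
      by_cases hmin : ∃ l < k, CanCapture G Set.univ l (σ.cop r t) (r t)
      · obtain ⟨l, hl, h⟩ := hmin
        exact ih l hl t h
      · push Not at hmin
        cases k with
        | zero => exact ht.elim
        | succ k =>
          rcases hmv2 _ _ k ht hmin with h | h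
          · exact ⟨t, Or.inr h⟩
          · exact ih k (by omega) (t + 1) (h _ (hr t))
  exact key k 0 (h (r 0))

/-- Sending a vertex `z` to a vertex `u` that dominates it turns a win on `X \ {z}` into a win
on `X`. -/
theorem CanCapture.of_diff_singleton [DecidableEq V] {X : Set V} {z u : V} (hzu : G.Adj z u)
    (hu : u ∈ X) (hdom : ∀ w ∈ X, G.Adj z w → Move G u w) {k : ℕ} {c r : V} (hr : r ∈ X)
    (h : CanCapture G (X \ {z}) k c (if r = z then u else r)) : CanCapture G X (k + 1) c r := by
  induction k generalizing c r with
  | zero => exact h.elim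
  | succ k ih =>
    obtain ⟨c', ⟨hc', -⟩, hm, h⟩ := h
    refine ⟨c', hc', hm, ?_⟩
    rcases h with h | h
    · split_ifs at h with hrz
      -- The cop has caught the shadow `u` while the robber is at `z`. Wherever the robber goes from
      -- `z` is within one move of `u`; this costs the extra round.
      · subst h hrz
        refine Or.inr fun r' hr' hrr => ⟨r', hr', ?_, Or.inl rfl⟩
        rcases hrr with rfl | hrr
        · exact Or.inr hzu.symm
        · exact hdom r' hr' hrr
      · exact Or.inl h
    · refine Or.inr fun r' hr' hrr => ih hr' (h _ ?_ ?_)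
      · split_ifs with h1
        · exact ⟨hu, hzu.ne'⟩
        · exact ⟨hr', h1⟩
      · split_ifs with h1 h2 h2
        · exact Or.inl rfl
        · subst h1
          rcases hrr with rfl | hrr
          · exact absurd rfl h2
          · exact hdom r' hr' hrr
        · subst h2
          rcases hrr with rfl | hrr
          · exact absurd rfl h1
          · have := hdom r hr hrr.symm
            rcases this with rfl | h
            · exact Or.inl rfl
            · exact Or.inr h.symm
        · exact hrr

end CopsRobbers

/-! ### Chordal graphs: simplicial vertices and dismantling -/

namespace CopsRobbers

variable {V : Type*} {G : SimpleGraph V}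

open Relation

theorem cycleGraph_adj_iff_val {n : ℕ} (hn : 3 < n) (u v : Fin n) :
    (SimpleGraph.cycleGraph n).Adj u v ↔ u.val + 1 = v.val ∨ v.val + 1 = u.val ∨
      (u.val = 0 ∧ v.val + 1 = n) ∨ (v.val = 0 ∧ u.val + 1 = n) := by
  obtain ⟨u, hu⟩ := u
  obtain ⟨v, hv⟩ := v
  simp only [SimpleGraph.cycleGraph_adj', Fin.sub_def]
  have e : ∀ a b : ℕ, a < n → b < n → (n - b + a) % n = if b ≤ a then a - b else n - b + a := by
    intro a b ha hb
    split_ifs with h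
    · rw [show n - b + a = (a - b) + n by omega, Nat.add_mod_right, Nat.mod_eq_of_lt (by omega)]
    · exact Nat.mod_eq_of_lt (by omega)
  rw [e u v hu hv, e v u hv hu]
  split_ifs <;> omega

/-- The step relation of the subgraph induced by `X`. -/
def StepIn (G : SimpleGraph V) (X : Set V) (a b : V) : Prop := G.Adj a b ∧ a ∈ X ∧ b ∈ X

theorem StepIn.symm {X : Set V} {a b : V} (h : StepIn G X a b) : StepIn G X b a :=
  ⟨h.1.symm, h.2.2, h.2.1⟩

theorem reflTransGen_stepIn_symm {X : Set V} {a b : V} (h : ReflTransGen (StepIn G X) a b) :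
    ReflTransGen (StepIn G X) b a := by
  induction h with
  | refl => exact .refl
  | tail _ h ih => exact .head h.symm ih

theorem reachable_induce {X : Set V} {a b : V} (h : ReflTransGen (StepIn G X) a b) (ha : a ∈ X)
    (hb : b ∈ X) : (G.induce X).Reachable ⟨a, ha⟩ ⟨b, hb⟩ := by
  induction h with
  | refl => exact SimpleGraph.Reachable.refl _
  | tail _ h ih => exact (ih h.2.1).trans (SimpleGraph.Adj.reachable (by simpa using h.1))

/-- Two neighbours of `v` that are joined by a path through non-neighbours of `v` are adjacent in a
chordal graph. -/
theorem IsChordal.adj_of_reachable (hG : IsChordal G) {v s t : V} {Y : Set V} (hvs : G.Adj v s)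
    (hvt : G.Adj v t) (hne : s ≠ t) (hY : ∀ w ∈ Y, w ≠ s → w ≠ t → w ≠ v ∧ ¬ G.Adj v w)
    (hs : s ∈ Y) (ht : t ∈ Y) (hr : (G.induce Y).Reachable ⟨s, hs⟩ ⟨t, ht⟩) : G.Adj s t := by
  by_contra hst
  -- A shortest walk is an induced path. If `s` and `t` were not adjacent it would have length `k ≥
  -- 2`, and closing it up through `v` would give an induced cycle of length `k + 2`.
  obtain ⟨p, hp⟩ := hr.exists_walk_length_eq_dist
  have hk : 1 < p.length := by
    rw [hp]
    exact hr.one_lt_dist_of_ne_of_not_adj (by simpa using hne) (by simpa using hst)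
  set k := p.length with hkdef
  have hd : ∀ i ≤ k, (G.induce Y).dist ⟨s, hs⟩ (p.getVert i) = i := by
    intro i hi
    have h1 := SimpleGraph.dist_le (p.take i)
    have h2 := SimpleGraph.dist_le (p.drop i)
    have h3 := SimpleGraph.Reachable.dist_triangle_left (p.take i).reachable ⟨t, ht⟩
    rw [SimpleGraph.Walk.take_length] at h1
    rw [SimpleGraph.Walk.drop_length] at h2
    omega
  have hinj : ∀ i ≤ k, ∀ j ≤ k, p.getVert i = p.getVert j → i = j := by
    intro i hi j hj h
    rw [← hd i hi, h, hd j hj]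
  have hstep : ∀ i < k, G.Adj (p.getVert i : V) (p.getVert (i + 1)) := by
    intro i hi
    simpa using p.adj_getVert_succ hi
  have hfar : ∀ i ≤ k, ∀ j ≤ k, G.Adj (p.getVert i : V) (p.getVert j) → i + 1 = j ∨ j + 1 = i := by
    intro i hi j hj h
    have h' : (G.induce Y).Adj (p.getVert i) (p.getVert j) := by simpa using h
    have h0 := h'.diff_dist_adj (u := ⟨s, hs⟩)
    have hij : i ≠ j := fun e => h.ne (by rw [e])
    rw [hd i hi, hd j hj] at h0
    omega
  have h0 : p.getVert 0 = ⟨s, hs⟩ := p.getVert_zero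
  have hlast : p.getVert k = ⟨t, ht⟩ := p.getVert_length
  have hmid : ∀ i, 0 < i → i < k →
      (p.getVert i : V) ≠ v ∧ ¬ G.Adj v (p.getVert i) := by
    intro i hi hik
    refine hY _ (p.getVert i).2 (fun h => ?_) (fun h => ?_)
    · have := hinj i hik.le 0 (by omega) (by rw [h0]; exact Subtype.ext h)
      omega
    · have := hinj i hik.le k le_rfl (by rw [hlast]; exact Subtype.ext h)
      omega
  have hvadj : ∀ i ≤ k, (G.Adj v (p.getVert i) ↔ i = 0 ∨ i = k) := by
    intro i hi
    constructor
    · intro h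
      by_contra hc
      exact (hmid i (by omega) (by omega)).2 h
    · rintro (rfl | rfl)
      · rwa [h0]
      · rwa [hlast]
  have hvne : ∀ i ≤ k, (p.getVert i : V) ≠ v := by
    intro i hi h
    rcases Nat.eq_zero_or_pos i with rfl | h'
    · rw [h0] at h
      exact hvs.ne h.symm
    · rcases hi.lt_or_eq with h'' | rfl
      · exact (hmid i h' h'').1 h
      · rw [hlast] at h
        exact hvt.ne h.symm
  let c : Fin (k + 2) → V := fun i => if i.val ≤ k then (p.getVert i.val : V) else v
  have hcinj : Function.Injective c := by
    intro i j hij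
    simp only [c] at hij
    have := i.2
    have := j.2
    apply Fin.ext
    split_ifs at hij with h1 h2 h2
    · exact hinj _ h1 _ h2 (Subtype.ext hij)
    · exact absurd hij (hvne _ h1)
    · exact absurd hij.symm (hvne _ h2)
    · omega
  refine hG (k + 2) (by omega) ⟨⟨⟨c, hcinj⟩, ?_⟩⟩
  intro i j
  rw [cycleGraph_adj_iff_val (by omega)]
  simp only [Function.Embedding.coeFn_mk, c]
  have hi := i.2
  have hj := j.2
  split_ifs with h1 h2 h2
  · constructor
    · intro h
      have := hfar _ h1 _ h2 h
      omega
    · intro h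
      have h' : i.val + 1 = j.val ∨ j.val + 1 = i.val := by omega
      rcases h' with h' | h'
      · rw [← h']
        exact hstep _ (by omega)
      · rw [← h']
        exact (hstep _ (by omega)).symm
  · rw [G.adj_comm, hvadj _ h1]
    omega
  · rw [hvadj _ h2]
    omega
  · simp only [SimpleGraph.irrefl, false_iff]
    omega

/-- Dirac's theorem: among the vertices in `X` that are not neighbours of `v`, there is one that is
simplicial in the subgraph induced by `X`. -/
theorem IsChordal.exists_simplicial [Finite V] (hG : IsChordal G) (X : Set V) {v u : V}
    (hv : v ∈ X) (hu : u ∈ X) (huv : u ≠ v) (hvu : ¬ G.Adj v u) :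
    ∃ z ∈ X, z ≠ v ∧ ¬ G.Adj v z ∧
      ∀ a ∈ X, ∀ b ∈ X, G.Adj z a → G.Adj z b → a ≠ b → G.Adj a b := by
  induction hn : X.ncard using Nat.strong_induction_on generalizing X v u with
  | _ n ih =>
    set N : Set V := {w | w ∈ X ∧ w ≠ v ∧ ¬ G.Adj v w} with hN
    -- `H` is the component of `u` among the non-neighbours of `v`, and `S` below its attachment set
    -- in the neighbourhood of `v`. Neighbours in `X` of a vertex of `H` stay in `H ∪ S`, so a
    -- vertex of `H` simplicial in `H ∪ S` is simplicial in `X`.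
    set H : Set V := {w | w ∈ N ∧ ReflTransGen (StepIn G N) u w} with hH
    set S : Set V := {s | s ∈ X ∧ G.Adj v s ∧ ∃ h ∈ H, G.Adj h s} with hS
    have huH : u ∈ H := ⟨⟨hu, huv, hvu⟩, .refl⟩
    have hHN : ∀ a ∈ H, ∀ b ∈ X, G.Adj a b → b ∈ H ∪ S := by
      intro a ha b hb hab
      by_cases hvb : G.Adj v b
      · exact Or.inr ⟨hb, hvb, a, ha, hab⟩
      · have hbN : b ∈ N := ⟨hb, fun e => ha.1.2.2 (e ▸ hab.symm), hvb⟩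
        exact Or.inl ⟨hbN, ha.2.tail ⟨hab, ha.1, hbN⟩⟩
    have hSS : ∀ s ∈ S, ∀ t ∈ S, s ≠ t → G.Adj s t := by
      rintro s ⟨hsX, hvs, a, ha, has⟩ t ⟨htX, hvt, b, hb, hbt⟩ hst
      refine hG.adj_of_reachable (Y := insert s (insert t N)) hvs hvt hst ?_ (by simp) (by simp) ?_
      · rintro w (rfl | rfl | hw) h1 h2
        · exact absurd rfl h1
        · exact absurd rfl h2
        · exact hw.2
      · have hsub : N ⊆ insert s (insert t N) := fun w hw => Or.inr (Or.inr hw)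
        have hab : ReflTransGen (StepIn G (insert s (insert t N))) a b :=
          ReflTransGen.mono (fun c d h => ⟨h.1, hsub h.2.1, hsub h.2.2⟩) _ _
            ((reflTransGen_stepIn_symm ha.2).trans hb.2)
        exact reachable_induce (.head ⟨has.symm, by simp, hsub ha.1⟩
          (hab.tail ⟨hbt, hsub hb.1, by simp⟩)) _ _
    have hXX : H ∪ S ⊆ X := by
      rintro w (hw | hw)
      · exact hw.1.1
      · exact hw.1
    have hvX : v ∉ H ∪ S := by
      rintro (hw | hw)
      · exact hw.1.2.1 rfl
      · exact hw.2.1.ne rfl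
    have hcard : (H ∪ S).ncard < n := by
      rw [← hn]
      exact Set.ncard_lt_ncard ⟨hXX, fun h => hvX (h hv)⟩ (Set.toFinite X)
    suffices hz : ∃ z ∈ H, ∀ a ∈ H ∪ S, ∀ b ∈ H ∪ S,
        G.Adj z a → G.Adj z b → a ≠ b → G.Adj a b by
      obtain ⟨z, hz, h⟩ := hz
      exact ⟨z, hz.1.1, hz.1.2.1, hz.1.2.2, fun a ha b hb hza hzb =>
        h a (hHN z hz a ha hza) b (hHN z hz b hb hzb) hza hzb⟩
    -- The induction on `H ∪ S` must return a vertex of `H`. Choosing the base vertex `w` in `S`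
    -- when possible ensures this: `S` is a clique, so a non-neighbour of `w` other than `w` lies in
    -- `H`. Otherwise each vertex of `S` is adjacent to all others, and any base vertex in `H`
    -- serves. If there is none either, `H ∪ S` is a clique.
    by_cases h1 : ∃ w ∈ S, ∃ x ∈ H ∪ S, x ≠ w ∧ ¬ G.Adj w x
    · obtain ⟨w, hw, x, hx, hxw, hwx⟩ := h1
      obtain ⟨z, hz, hzw, hwz, h⟩ := ih _ hcard (H ∪ S) (Or.inr hw) hx hxw hwx rfl
      exact ⟨z, hz.resolve_right fun hzS => hwz (hSS w hw z hzS hzw.symm), h⟩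
    · push Not at h1
      by_cases h2 : ∃ w ∈ H, ∃ x ∈ H ∪ S, x ≠ w ∧ ¬ G.Adj w x
      · obtain ⟨w, hw, x, hx, hxw, hwx⟩ := h2
        obtain ⟨z, hz, hzw, hwz, h⟩ := ih _ hcard (H ∪ S) (Or.inl hw) hx hxw hwx rfl
        exact ⟨z, hz.resolve_right fun hzS => hwz (h1 z hzS w (Or.inl hw) hzw.symm).symm, h⟩
      · push Not at h2
        refine ⟨u, huH, fun a ha b hb _ _ hab => ?_⟩
        rcases ha with ha | ha
        · exact h2 a ha b hb hab.symm
        · exact h1 a ha b hb hab.symm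

/-- Deleting a simplicial vertex `z` keeps the induced subgraph connected, since folding `z` onto a
neighbour `u` maps walks to walks. The win on `X \ {z}` then lifts at the cost of one round. -/
theorem IsChordal.exists_canCapture [Finite V] (hG : IsChordal G) (X : Set V) (hX : X.Nonempty)
    (hc : ∀ a ∈ X, ∀ b ∈ X, ReflTransGen (StepIn G X) a b) :
    ∃ k, ∃ c ∈ X, ∀ r ∈ X, CanCapture G X k c r := by
  classical
  induction hn : X.ncard using Nat.strong_induction_on generalizing X with
  | _ n ih =>
    by_cases hs : X.Subsingleton
    · obtain ⟨x, hx⟩ := hX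
      exact ⟨1, x, hx, fun r hr => ⟨x, hx, Or.inl rfl, Or.inl (hs hx hr)⟩⟩
    have hz : ∃ z ∈ X, ∀ a ∈ X, ∀ b ∈ X, G.Adj z a → G.Adj z b → a ≠ b → G.Adj a b := by
      by_cases h : ∃ v ∈ X, ∃ u ∈ X, u ≠ v ∧ ¬ G.Adj v u
      · obtain ⟨v, hv, u, hu, huv, hvu⟩ := h
        obtain ⟨z, hz, -, -, h⟩ := hG.exists_simplicial X hv hu huv hvu
        exact ⟨z, hz, h⟩
      · push Not at h
        obtain ⟨x, hx⟩ := hX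
        exact ⟨x, hx, fun a ha b hb _ _ hab => h a ha b hb hab.symm⟩
    obtain ⟨z, hz, hsimp⟩ := hz
    have hu : ∃ u ∈ X, G.Adj z u := by
      obtain ⟨w, hw, hwz⟩ := (Set.not_subsingleton_iff.1 hs).exists_ne z
      rcases (hc z hz w hw).cases_head with h | ⟨u, h, -⟩
      · exact absurd h.symm hwz
      · exact ⟨u, h.2.2, h.1⟩
    obtain ⟨u, hu, hzu⟩ := hu
    have hdom : ∀ w ∈ X, G.Adj z w → Move G u w := by
      intro w hw hzw
      by_cases huw : u = w
      · exact Or.inl huw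
      · exact Or.inr (hsimp u hu w hw hzu hzw huw)
    have huz : u ∈ X \ {z} := ⟨hu, hzu.ne'⟩
    set φ : V → V := fun w => if w = z then u else w with hφ
    have hφX : ∀ w ∈ X, φ w ∈ X \ {z} := by
      intro w hw
      simp only [hφ]
      split_ifs with h
      · exact huz
      · exact ⟨hw, h⟩
    have hlift : ∀ a b, ReflTransGen (StepIn G X) a b →
        ReflTransGen (StepIn G (X \ {z})) (φ a) (φ b) := by
      intro a b hab
      refine hab.lift' φ fun c d hcd => ?_
      have hmv : Move G (φ c) (φ d) := by
        simp only [hφ]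
        split_ifs with h1 h2 h2
        · exact Or.inl rfl
        · subst h1
          exact hdom d hcd.2.2 hcd.1
        · subst h2
          rcases hdom c hcd.2.1 hcd.1.symm with h | h
          · exact Or.inl h.symm
          · exact Or.inr h.symm
        · exact Or.inr hcd.1
      rcases hmv with h | h
      · rw [Function.onFun, h]
      · exact .single ⟨h, hφX c hcd.2.1, hφX d hcd.2.2⟩
    obtain ⟨k, c, hcX, h⟩ := ih _ (by
      rw [← hn]
      exact Set.ncard_lt_ncard ⟨Set.sdiff_subset, fun h => (h hz).2 rfl⟩ (Set.toFinite X))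
      (X \ {z}) ⟨u, huz⟩ (fun a ha b hb => by
        have := hlift a b (hc a ha.1 b hb.1)
        simpa only [hφ, if_neg (show ¬ a = z from ha.2), if_neg (show ¬ b = z from hb.2)]
          using this) rfl
    exact ⟨k + 1, c, hcX.1, fun r hr => .of_diff_singleton hzu hu hdom hr (h _ (hφX r hr))⟩

theorem IsChordal.isCopWin [Finite V] (hG : IsChordal G) (hc : G.Connected) : IsCopWin G := by
  have := hc.nonempty
  obtain ⟨k, c, -, h⟩ := hG.exists_canCapture Set.univ Set.univ_nonempty fun a _ b _ => by
    have := (G.reachable_iff_reflTransGen a b).1 (hc.preconnected a b)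
    exact ReflTransGen.mono (fun c d h => ⟨h, trivial, trivial⟩) _ _ this
  exact isCopWin_of_canCapture fun r => h r trivial

end CopsRobbers

/-! ### Outerplanar graphs retract onto their long induced cycles -/

namespace CopsRobbers

variable {V : Type*} {G : SimpleGraph V}

open Relation

/-- The extra point `p n` covers `n = 0`, which occurs as the rest of a one-segment arc after its
first segment. -/
theorem isAngle_polygon (p : ℕ → Plane) (n : ℕ) :
    ∃ B, IsAngle ({p n} ∪ ⋃ i ∈ Set.Iio n, segment ℝ (p i) (p (i + 1))) (p 0) (p n) B ∧
      IsPreconnected ({p n} ∪ ⋃ i ∈ Set.Iio n, segment ℝ (p i) (p (i + 1))) := by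
  induction n with
  | zero =>
    simpa using ⟨⟨0, .refl _⟩, isPreconnected_singleton⟩
  | succ n ih =>
    obtain ⟨B, hB, hc⟩ := ih
    have e : ({p (n + 1)} ∪ ⋃ i ∈ Set.Iio (n + 1), segment ℝ (p i) (p (i + 1))) =
        ({p n} ∪ ⋃ i ∈ Set.Iio n, segment ℝ (p i) (p (i + 1))) ∪
          segment ℝ (p n) (p (n + 1)) := by
      ext q
      simp only [Set.mem_union, Set.mem_singleton_iff, Set.mem_iUnion, Set.mem_Iio, exists_prop]
      constructor
      · rintro (rfl | ⟨i, hi, hq⟩)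
        · exact Or.inr (right_mem_segment ℝ _ _)
        · rcases Nat.lt_succ_iff_lt_or_eq.1 hi with hi | rfl
          · exact Or.inl (Or.inr ⟨i, hi, hq⟩)
          · exact Or.inr hq
      · rintro ((rfl | ⟨i, hi, hq⟩) | hq)
        · exact Or.inr ⟨n, n.lt_succ_self, left_mem_segment ℝ _ _⟩
        · exact Or.inr ⟨i, hi.trans n.lt_succ_self, hq⟩
        · exact Or.inr ⟨n, n.lt_succ_self, hq⟩
    rw [e]
    exact ⟨_, hB.trans (isAngle_segment _ _),
      hc.union (p n) (Or.inl rfl) (left_mem_segment ℝ _ _) (convex_segment _ _).isPreconnected⟩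

/-- A polygonal arc starts with a segment that does not meet the rest of the arc near the start. -/
theorem IsPolygonalArc.exists_first_segment {A : Set Plane} {x y : Plane}
    (h : IsPolygonalArc A x y) :
    ∃ v K B, v ≠ x ∧ A = segment ℝ x v ∪ K ∧ x ∉ K ∧ IsAngle K v y B ∧
      IsPreconnected (A \ {x}) := by
  obtain ⟨n, p, hn, rfl, rfl, hne, hcons, hdisj, rfl⟩ := h
  obtain ⟨n, rfl⟩ : ∃ m, n = m + 1 := ⟨n - 1, by omega⟩
  obtain ⟨B, hB, hc⟩ := isAngle_polygon (fun i => p (i + 1)) n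
  set K : Set Plane := {p (n + 1)} ∪ ⋃ i ∈ Set.Iio n, segment ℝ (p (i + 1)) (p (i + 1 + 1)) with hK
  have hseg : ∀ i < n, p 0 ∉ segment ℝ (p (i + 1)) (p (i + 1 + 1)) := by
    intro i hi hp
    cases i with
    | zero =>
      have := hcons 0 (by omega)
      have h0 : p 0 ∈ ({p (0 + 1)} : Set Plane) := by
        rw [← this]
        exact ⟨left_mem_segment ℝ _ _, hp⟩
      exact hne 0 (by omega) h0
    | succ i =>
      exact Set.disjoint_left.1 (hdisj 0 (i + 1 + 1) (by omega) (by omega))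
        (left_mem_segment ℝ _ _) hp
  have hxK : p 0 ∉ K := by
    rintro (hp | hp)
    · rcases Nat.eq_zero_or_pos n with rfl | hn'
      · exact hne 0 (by omega) hp
      · obtain ⟨m, rfl⟩ : ∃ m, n = m + 1 := ⟨n - 1, by omega⟩
        refine hseg m (by omega) ?_
        rw [show p 0 = p (m + 1 + 1) from hp]
        exact right_mem_segment ℝ _ _
    · simp only [Set.mem_iUnion, Set.mem_Iio, exists_prop] at hp
      obtain ⟨i, hi, hp⟩ := hp
      exact hseg i hi hp
  have e : (⋃ i ∈ Set.Iio (n + 1), segment ℝ (p i) (p (i + 1))) =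
      segment ℝ (p 0) (p 1) ∪ K := by
    ext q
    simp only [hK, Set.mem_union, Set.mem_singleton_iff, Set.mem_iUnion, Set.mem_Iio, exists_prop]
    constructor
    · rintro ⟨i, hi, hq⟩
      cases i with
      | zero => exact Or.inl hq
      | succ i => exact Or.inr (Or.inr ⟨i, by omega, hq⟩)
    · rintro (hq | rfl | ⟨i, hi, hq⟩)
      · exact ⟨0, by omega, hq⟩
      · exact ⟨n, by omega, right_mem_segment ℝ _ _⟩
      · exact ⟨i + 1, by omega, hq⟩
  refine ⟨p 1, K, B, (hne 0 (by omega)).symm, e, hxK, hB, ?_⟩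
  have e' : (⋃ i ∈ Set.Iio (n + 1), segment ℝ (p i) (p (i + 1))) \ {p 0} =
      (fun t : ℝ => p 0 + t • (p 1 - p 0)) '' Set.Ioc 0 1 ∪ K := by
    have hsub : p 1 - p 0 ≠ 0 := sub_ne_zero.2 (hne 0 (by omega)).symm
    rw [e, Set.union_sdiff_distrib, Set.sdiff_singleton_eq_self hxK, segment_eq_image']
    congr 1
    ext q
    constructor
    · rintro ⟨⟨t, ⟨h0, h1⟩, rfl⟩, hq⟩
      refine ⟨t, ⟨lt_of_le_of_ne h0 ?_, h1⟩, rfl⟩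
      rintro rfl
      simp at hq
    · rintro ⟨t, ⟨h0, h1⟩, rfl⟩
      refine ⟨⟨t, ⟨h0.le, h1⟩, rfl⟩, ?_⟩
      simpa [h0.ne'] using hsub
  rw [e']
  refine IsPreconnected.union (p 1) ⟨1, by simp, by simp⟩ hB.left_mem ?_ hc
  exact isPreconnected_Ioc.image _ (by fun_prop)

/-- A walk in a plane graph gives a curve made of arcs. -/
theorem PlaneDrawing.exists_isAngle (D : PlaneDrawing G) {X : Set V} {u v : V}
    (h : ReflTransGen (StepIn G X) u v) :
    ∃ K B, IsAngle K (D.pos u) (D.pos v) B ∧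
      ∀ q ∈ K, q = D.pos u ∨ ∃ e : G.edgeSet, q ∈ D.arc e ∧ ∀ w ∈ (e : Sym2 V), w ∈ X := by
  induction h with
  | refl => exact ⟨_, _, .refl _, fun q hq => Or.inl hq⟩
  | @tail a b _ h ih =>
    obtain ⟨K, B, hB, hK⟩ := ih
    obtain ⟨v, L, C, -, hA, -, hC, -⟩ := (D.isArc a b h.1).exists_first_segment
    refine ⟨_, _, hB.trans ((isAngle_segment _ v).trans hC), ?_⟩
    rintro q (hq | hq)
    · exact hK q hq
    · rw [← hA] at hq
      refine Or.inr ⟨_, hq, fun w hw => ?_⟩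
      rcases Sym2.mem_iff.1 hw with rfl | rfl
      · exact h.2.1
      · exact h.2.2

/-- In a plane graph, three neighbours of `x` that are joined to a common vertex by walks avoiding
`x` and the other two do not all lie on the boundary of the outer face. -/
theorem PlaneDrawing.not_three_walks (D : PlaneDrawing G) {x y : V} {m : Fin 3 → V}
    {X : Fin 3 → Set V} (hxm : ∀ i, G.Adj x (m i)) (hxX : ∀ i, x ∉ X i) (hmX : ∀ i, m i ∈ X i)
    (hmX' : ∀ i j, i ≠ j → m i ∉ X j) (hw : ∀ i, ReflTransGen (StepIn G (X i)) (m i) y)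
    (hD : ∀ i, D.pos (m i) ∈ frontier D.outerFace) : False := by
  choose v L B hv hA hxL hB hconn using fun i => (D.isArc x (m i) (hxm i)).exists_first_segment
  choose K C hC hK using fun i => D.exists_isAngle (hw i)
  have hmm : ∀ i j, i ≠ j → m i ≠ m j := fun i j hij e => hmX' i j hij (e ▸ hmX j)
  -- Distinct arcs meet only in vertices, and the only vertex on this arc besides `x` is `m i`. This
  -- gives the disjointness of the arc without `x` from the other two curves.
  have hmem : ∀ i, ∀ q ∈ D.arc ⟨s(x, m i), hxm i⟩, q ≠ D.pos x → ∀ e : G.edgeSet, q ∈ D.arc e →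
      m i ∈ (e : Sym2 V) := by
    intro i q hq hqx e hqe
    by_cases he : e = ⟨s(x, m i), hxm i⟩
    · rw [he]
      exact Sym2.mem_mk_right _ _
    · obtain ⟨w, rfl⟩ := D.arc_inter_arc _ _ he ⟨hqe, hq⟩
      rcases Sym2.mem_iff.1 (D.vertex_on_arc _ _ hq) with rfl | rfl
      · exact absurd rfl hqx
      · exact D.vertex_on_arc _ _ hqe
  have harc : ∀ i, ∀ q ∈ D.arc ⟨s(x, m i), hxm i⟩, q ∈ D.support :=
    fun i q hq => Or.inr (Set.mem_iUnion.2 ⟨_, hq⟩)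
  refine not_three_arcs (x := D.pos x) (y := D.pos y) (v := v) (K := fun i => L i ∪ K i)
    (B := fun i => B i + C i) hv (fun i => (hB i).trans (hC i)) ?_
    (T := fun i => D.arc ⟨s(x, m i), hxm i⟩ \ {D.pos x}) hconn ?_ ?_ (O := D.outerFace) ?_
    (m := fun i => D.pos (m i)) ?_ (fun i => frontier_subset_closure (hD i))
  · rintro i (h | h)
    · exact hxL i h
    · rcases hK i _ h with h | ⟨e, he, heX⟩
      · exact (hxm i).ne (D.pos_injective h)
      · exact hxX i (heX x (D.vertex_on_arc e x he))
  · intro i t h0 h1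
    refine ⟨?_, ?_⟩
    · rw [hA i, segment_eq_image']
      exact Or.inl ⟨t, ⟨h0.le, h1⟩, rfl⟩
    · simpa [h0.ne', sub_eq_zero] using hv i
  · intro i j hij
    rw [Set.disjoint_left]
    rintro q ⟨hq, hqx⟩ hq'
    have hq' : q ∈ D.arc ⟨s(x, m j), hxm j⟩ ∨ q ∈ K j := by
      rw [hA j]
      rcases hq' with h | h | h
      · exact Or.inl (Or.inl h)
      · exact Or.inl (Or.inr h)
      · exact Or.inr h
    rcases hq' with h | h
    · rcases Sym2.mem_iff.1 (hmem i q hq hqx _ h) with h | h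
      · exact (hxm i).ne h.symm
      · exact hmm i j hij h
    · rcases hK j q h with rfl | ⟨e, he, heX⟩
      · rcases Sym2.mem_iff.1 (D.vertex_on_arc _ _ hq) with h | h
        · exact (hxm j).ne h.symm
        · exact hmm i j hij h.symm
      · exact hmX' i j hij (heX _ (hmem i q hq hqx e he))
  · rintro z ⟨hz, hzb⟩
    refine ⟨_, isPreconnected_connectedComponentIn, mem_connectedComponentIn hz, hzb, fun i => ?_⟩
    rw [Set.disjoint_left]
    intro q hq hq'
    refine connectedComponentIn_subset _ _ hq ?_
    rcases hq' with h | h | h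
    · exact harc i q (by rw [hA i]; exact Or.inl h)
    · exact harc i q (by rw [hA i]; exact Or.inr h)
    · rcases hK i q h with rfl | ⟨e, he, -⟩
      · exact Or.inl ⟨_, rfl⟩
      · exact Or.inr (Set.mem_iUnion.2 ⟨e, he⟩)
  · intro i
    refine ⟨?_, fun h => (hxm i).ne (D.pos_injective h).symm⟩
    rw [hA i]
    exact Or.inr (hB i).right_mem

/-- An induced cycle, numbered from a given vertex on. -/
theorem exists_cycle_numbering {n : ℕ} (hn : 3 < n) (f : SimpleGraph.cycleGraph n ↪g G)
    (a : Fin n) :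
    ∃ g : ℕ → V, g 0 = f a ∧ (∀ i < n, ∀ j < n, g i = g j → i = j) ∧
      (∀ i, i + 1 < n → G.Adj (g i) (g (i + 1))) ∧ G.Adj (g 0) (g (n - 1)) ∧
      (∀ i, g i ∈ Set.range f) ∧ ∀ b, ∃ j < n, g j = f b := by
  have : NeZero n := ⟨by omega⟩
  have hadj : ∀ i j : Fin n, (SimpleGraph.cycleGraph n).Adj i j →
      G.Adj (f (a + i)) (f (a + j)) := by
    intro i j h
    rw [SimpleGraph.cycleGraph_adj'] at h
    rw [f.map_adj_iff, SimpleGraph.cycleGraph_adj']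
    simpa using h
  refine ⟨fun i => f (a + Fin.ofNat n i), by simp, ?_, ?_, ?_, fun i => ⟨_, rfl⟩, ?_⟩
  · intro i hi j hj h
    have h := congrArg Fin.val (add_left_cancel (f.injective h))
    simpa [Nat.mod_eq_of_lt hi, Nat.mod_eq_of_lt hj] using h
  · intro i hi
    apply hadj
    rw [cycleGraph_adj_iff_val hn]
    simp [Nat.mod_eq_of_lt hi, Nat.mod_eq_of_lt (show i < n by omega)]
  · apply hadj
    rw [cycleGraph_adj_iff_val hn]
    refine Or.inr (Or.inr (Or.inl ⟨by simp, ?_⟩))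
    simp only [Fin.val_ofNat, Nat.mod_eq_of_lt (show n - 1 < n by omega)]
    omega
  · intro b
    refine ⟨(b - a).val, (b - a).2, ?_⟩
    simp

/-- In an outerplanar graph, two neighbours on an induced cycle of a component of the rest of the
graph are equal or adjacent. -/
theorem IsOuterplanar.eq_or_adj_of_attached (hG : IsOuterplanar G) {n : ℕ} (hn : 3 < n)
    (f : SimpleGraph.cycleGraph n ↪g G) {a b : Fin n} {h₁ h₂ : V} (ha : G.Adj (f a) h₁)
    (hb : G.Adj h₂ (f b)) (hh₁ : h₁ ∉ Set.range f) (hh₂ : h₂ ∉ Set.range f)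
    (hw : ReflTransGen (StepIn G (Set.range f)ᶜ) h₁ h₂) :
    a = b ∨ (SimpleGraph.cycleGraph n).Adj a b := by
  by_contra hab
  rw [not_or] at hab
  obtain ⟨D, hD⟩ := hG
  obtain ⟨g, hg0, hginj, hgadj, hglast, hgf, hfg⟩ := exists_cycle_numbering hn f a
  obtain ⟨j, hj, hjb⟩ := hfg b
  have hj0 : j ≠ 0 := by
    rintro rfl
    exact hab.1 (f.injective (hg0.symm.trans hjb))
  have hj1 : j ≠ 1 := by
    rintro rfl
    have := hgadj 0 (by omega)
    rw [hg0, zero_add, hjb, f.map_adj_iff] at this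
    exact hab.2 this
  have hjn : j ≠ n - 1 := by
    rintro rfl
    rw [hg0, hjb, f.map_adj_iff] at hglast
    exact hab.2 hglast
  -- The three routes to `g j`: the two sides of the cycle, and the detour through the component.
  -- All omit `g 0`, and any two share only `g j`.
  let X₁ : Set V := {w | ∃ i, 1 ≤ i ∧ i ≤ j ∧ g i = w}
  let X₂ : Set V := {w | ∃ i, j ≤ i ∧ i < n ∧ g i = w}
  let X₃ : Set V := insert (g j) (Set.range f)ᶜ
  have hw₁ : ReflTransGen (StepIn G X₁) (g 1) (g j) := by
    have : ∀ i, i + 1 ≤ j → ReflTransGen (StepIn G X₁) (g 1) (g (i + 1)) := by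
      intro i
      induction i with
      | zero => exact fun _ => .refl
      | succ i ih =>
        exact fun hi => (ih (by omega)).tail ⟨hgadj _ (by omega), ⟨_, by omega, by omega, rfl⟩,
          ⟨_, by omega, by omega, rfl⟩⟩
    simpa [Nat.sub_add_cancel (show 1 ≤ j by omega)] using this (j - 1) (by omega)
  have hw₂ : ReflTransGen (StepIn G X₂) (g (n - 1)) (g j) := by
    apply reflTransGen_stepIn_symm
    have : ∀ i, j + i < n → ReflTransGen (StepIn G X₂) (g j) (g (j + i)) := by
      intro i
      induction i with
      | zero => exact fun _ => .refl
      | succ i ih =>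
        exact fun hi => (ih (by omega)).tail ⟨hgadj _ (by omega), ⟨_, by omega, by omega, rfl⟩,
          ⟨_, by omega, by omega, rfl⟩⟩
    simpa [show j + (n - 1 - j) = n - 1 by omega] using this (n - 1 - j) (by omega)
  have hw₃ : ReflTransGen (StepIn G X₃) h₁ (g j) := by
    refine .tail (ReflTransGen.mono (fun c d h => ⟨h.1, Or.inr h.2.1, Or.inr h.2.2⟩) _ _ hw)
      ⟨?_, Or.inr hh₂, Or.inl rfl⟩
    rwa [hjb]
  have hne : ∀ i, g i ≠ h₁ := fun i e => hh₁ (e ▸ hgf i)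
  have hX₁ : ∀ i < n, g i ∈ X₁ → 1 ≤ i ∧ i ≤ j := by
    rintro i hi ⟨k, hk1, hk2, hk⟩
    have := hginj k (by omega) i hi hk
    omega
  have hX₂ : ∀ i < n, g i ∈ X₂ → j ≤ i := by
    rintro i hi ⟨k, hk1, hk2, hk⟩
    have := hginj k (by omega) i hi hk
    omega
  have hX₃ : ∀ i < n, g i ∈ X₃ → i = j := by
    rintro i hi (h | h)
    · exact hginj i hi j hj h
    · exact absurd (hgf i) h
  refine D.not_three_walks (x := g 0) (y := g j) (m := ![g 1, g (n - 1), h₁])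
    (X := ![X₁, X₂, X₃]) ?_ ?_ ?_ ?_ ?_ (fun i => hD _)
  · intro i
    fin_cases i
    · exact hgadj 0 (by omega)
    · exact hglast
    · simpa [hg0] using ha
  · intro i h
    fin_cases i
    · have := hX₁ 0 (by omega) h
      omega
    · have := hX₂ 0 (by omega) h
      omega
    · have := hX₃ 0 (by omega) h
      omega
  · intro i
    fin_cases i
    · exact ⟨1, le_rfl, by omega, rfl⟩
    · exact ⟨n - 1, by omega, by omega, rfl⟩
    · exact Or.inr hh₁
  · intro i k hik h
    fin_cases i <;> fin_cases k
    · exact hik rfl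
    · have := hX₂ 1 (by omega) h
      omega
    · have := hX₃ 1 (by omega) h
      omega
    · have := hX₁ (n - 1) (by omega) h
      omega
    · exact hik rfl
    · have := hX₃ (n - 1) (by omega) h
      omega
    · obtain ⟨l, -, -, hl⟩ := h
      exact hne l hl
    · obtain ⟨l, -, -, hl⟩ := h
      exact hne l hl
    · exact hik rfl
  · intro i
    fin_cases i
    · exact hw₁
    · exact hw₂
    · exact hw₃

/-- An outerplanar graph retracts onto each of its induced cycles of length at least four. -/
theorem IsOuterplanar.exists_retraction (hG : IsOuterplanar G) {n : ℕ} (hn : 3 < n)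
    (f : SimpleGraph.cycleGraph n ↪g G) :
    ∃ ρ : V → Fin n, (∀ a, ρ (f a) = a) ∧
      ∀ u v, G.Adj u v → ρ u = ρ v ∨ (SimpleGraph.cycleGraph n).Adj (ρ u) (ρ v) := by
  classical
  let P : V → Fin n → Prop := fun u a =>
    ∃ w, w ∉ Set.range f ∧ ReflTransGen (StepIn G (Set.range f)ᶜ) u w ∧ G.Adj w (f a)
  -- The value 0 serves components with no neighbour on the cycle. Since `pick` depends on the
  -- predicate alone, adjacent vertices off the cycle get the same image.
  let pick : (Fin n → Prop) → Fin n := fun Q => if h : ∃ a, Q a then h.choose else ⟨0, by omega⟩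
  have hpick : ∀ (Q : Fin n → Prop) (a : Fin n), Q a → Q (pick Q) := by
    intro Q a ha
    have h : ∃ a, Q a := ⟨a, ha⟩
    simp only [pick, dif_pos h]
    exact h.choose_spec
  let ρ : V → Fin n := fun u => if h : ∃ a, f a = u then h.choose else pick (P u)
  have hρf : ∀ a, ρ (f a) = a := by
    intro a
    have h : ∃ b, f b = f a := ⟨a, rfl⟩
    simp only [ρ, dif_pos h]
    exact f.injective h.choose_spec
  have hρ : ∀ u, u ∉ Set.range f → ρ u = pick (P u) := fun u hu => dif_neg hu
  have hmixed : ∀ u a, u ∉ Set.range f → G.Adj u (f a) →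
      ρ u = a ∨ (SimpleGraph.cycleGraph n).Adj (ρ u) a := by
    intro u a hu hua
    rw [hρ u hu]
    obtain ⟨w, hw, huw, hwa⟩ := hpick (P u) a ⟨u, hu, .refl, hua⟩
    exact hG.eq_or_adj_of_attached hn f hwa.symm hua hw hu (reflTransGen_stepIn_symm huw)
  refine ⟨ρ, hρf, fun u v huv => ?_⟩
  by_cases hu : u ∈ Set.range f
  · obtain ⟨a, rfl⟩ := hu
    by_cases hv : v ∈ Set.range f
    · obtain ⟨b, rfl⟩ := hv
      rw [hρf, hρf]
      exact Or.inr (f.map_adj_iff.1 huv)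
    · rw [hρf]
      exact (hmixed v a hv huv.symm).imp Eq.symm SimpleGraph.Adj.symm
  · by_cases hv : v ∈ Set.range f
    · obtain ⟨b, rfl⟩ := hv
      rw [hρf]
      exact hmixed u b hu huv
    · left
      rw [hρ u hu, hρ v hv]
      congr 1
      have hst : StepIn G (Set.range f)ᶜ u v := ⟨huv, hu, hv⟩
      funext a
      apply propext
      constructor
      · rintro ⟨w, hw, h, hwa⟩
        exact ⟨w, hw, .head hst.symm h, hwa⟩
      · rintro ⟨w, hw, h, hwa⟩
        exact ⟨w, hw, .head hst h, hwa⟩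

/-- When `s` is next to `i`, one step from `i` in the direction away from `s` reaches distance 2,
because the cycle has at least four vertices. -/
theorem cycleGraph_exists_escape {n : ℕ} (hn : 3 < n) {s i : Fin n} (hsi : s ≠ i) :
    ∃ j, Move (SimpleGraph.cycleGraph n) i j ∧ s ≠ j ∧ ¬ (SimpleGraph.cycleGraph n).Adj s j := by
  by_cases h : (SimpleGraph.cycleGraph n).Adj s i
  · have hs := s.2
    have hi := i.2
    rw [cycleGraph_adj_iff_val hn] at h
    have key : ∃ k, k < n ∧ (i.val + 1 = k ∨ k + 1 = i.val ∨ (i.val = 0 ∧ k + 1 = n) ∨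
        (k = 0 ∧ i.val + 1 = n)) ∧ s.val ≠ k ∧ ¬ (s.val + 1 = k ∨ k + 1 = s.val ∨
        (s.val = 0 ∧ k + 1 = n) ∨ (k = 0 ∧ s.val + 1 = n)) := by
      by_cases hup : s.val + 1 = i.val ∨ (i.val = 0 ∧ s.val + 1 = n)
      · by_cases hi1 : i.val + 1 < n
        · exact ⟨i.val + 1, by omega⟩
        · exact ⟨0, by omega⟩
      · by_cases hi1 : i.val = 0
        · exact ⟨n - 1, by omega⟩
        · exact ⟨i.val - 1, by omega⟩
    obtain ⟨k, hk, h1, h2, h3⟩ := key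
    refine ⟨⟨k, hk⟩, Or.inr ?_, fun e => h2 (by rw [e]), ?_⟩
    · rwa [cycleGraph_adj_iff_val hn]
    · rwa [cycleGraph_adj_iff_val hn]
  · exact ⟨i, Or.inl rfl, hsi, h⟩

/-- The robber stays on the cycle at distance at least 2 from the retracted cop. A cop's move shifts
this image by at most one step, so it cannot land on the robber, who then restores the distance. -/
theorem IsOuterplanar.isChordal_of_isCopWin (hG : IsOuterplanar G) (hw : IsCopWin G) :
    IsChordal G := by
  rintro n hn ⟨f⟩
  obtain ⟨ρ, hρf, hρ⟩ := hG.exists_retraction hn f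
  refine not_isCopWin_of_safe
    (fun c r => ∃ i, r = f i ∧ ρ c ≠ i ∧ ¬ (SimpleGraph.cycleGraph n).Adj (ρ c) i) ?_ ?_ ?_ hw
  · intro c
    have : Nontrivial (Fin n) := Fin.nontrivial_iff_two_le.2 (by omega)
    obtain ⟨i, hi⟩ := exists_ne (ρ c)
    obtain ⟨j, -, hj⟩ := cycleGraph_exists_escape hn hi.symm
    exact ⟨f j, j, rfl, hj⟩
  · rintro c r ⟨i, rfl, h, -⟩ rfl
    exact h (hρf i)
  · rintro c r c' ⟨i, rfl, h1, h2⟩ hm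
    have hi : ρ c' ≠ i := by
      rintro rfl
      rcases hm with rfl | hm
      · exact h1 rfl
      · exact (hρ c c' hm).elim h1 h2
    refine ⟨?_, ?_⟩
    · rintro rfl
      exact hi (hρf i)
    · obtain ⟨j, hij, hj⟩ := cycleGraph_exists_escape hn hi
      refine ⟨f j, hij.imp (congrArg f) f.map_adj_iff.2, j, rfl, hj⟩

end CopsRobbers

theorem theorem3p9 {V : Type*} [Finite V] (G : SimpleGraph V)
    (hG : CopsRobbers.IsOuterplanar G) :
    CopsRobbers.IsCopWin G ↔ (G.Connected ∧ CopsRobbers.IsChordal G) :=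
  ⟨fun h => ⟨h.connected, hG.isChordal_of_isCopWin h⟩, fun h => h.2.isCopWin h.1⟩
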